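/- Let $0<\alpha\le\lambda<1$ be fixed. For every $m\in\mathbb N=\{1,2,\dots\}$ let $p_{1,m},\dots,p_{m,m}$ be $[0,1]$-valued random variables ($p$-values) on a probability space $(\Omega_m,\mathcal A_m,P_m)$, and let $\{1,\dots,m\}=I_{0,m}\sqcup I_{1,m}$ be a nonrandom partition with $m_0:=\#I_{0,m}\ge 1$. Assume basic independence: the vectors $(p_{i,m})_{i\in I_{0,m}}$ and $(p_{i,m})_{i\in I_{1,m}}$ are independent, and the $p_{i,m}$, $i\in I_{0,m}$, are independent and uniformly distributed on $[0,1]$; the dependence among the $p_{i,m}$, $i\in I_{1,m}$, is arbitrary. Let $\widehat F_m$ be the empirical distribution function of $p_{1,m},\dots,p_{m,m}$, and let $R_m(t):=m\widehat F_m(t)$. Let $\widehat m_0>0$ be an estimator which is a measurable function of $(\widehat F_m(t))_{t\ge\lambda}$ (the function may depend on $m$). Put $$\widehat\alpha_{i:m}:=\min\Bigl\{\frac{i}{\widehat m_0}\,\alpha,\ \lambda\Bigr\},\qquad i=0,\dots,m,$$ let $p_{1:m}\le\dots\le p_{m:m}$ be the ordered $p$-values, $p_{0:m}:=0$, and let $$R_m:=\max\{i\in\{0,\dots,m\}:\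 p_{i:m}\le\widehat\alpha_{i:m}\}$$ be the number of rejections of the adaptive step-up test. Suppose that $m_0/m\to 1$ as $m\to\infty$, and that there is a constant $C>1$ with $$\lim_{m\to\infty}P_m\Bigl(\widehat m_0\ \ge\ \frac{C\alpha}{\lambda}\,\max\{R_m(\lambda),1\}\Bigr)=1 .$$ Then $\widehat\alpha_{R_m:m}\to 0$ in $P_m$-probability, that is, $P_m(\widehat\alpha_{R_m:m}\ge\varepsilon)\to 0$ for every $\varepsilon>0$. If, in addition, there is some $K>0$ such that $\widehat m_0\le Km$ almost surely for all $m\in\mathbb N$, then also $R_m/m\to 0$ in $P_m$-probability. -/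

import Mathlib

open Filter Topology MeasureTheory ProbabilityTheory

noncomputable section

namespace AdaptiveStepUp

/-- Convergence in `P m`-probability of `X m` to the constant `c`, where the `X m` may live on
different probability spaces. -/
def TendstoInProb {Ω : ℕ → Type*} [∀ m, MeasurableSpace (Ω m)] (P : ∀ m, Measure (Ω m))
    (X : ∀ m, Ω m → ℝ) (c : ℝ) : Prop :=
  ∀ ε : ℝ, 0 < ε → Tendsto (fun m => P m {ω | ε ≤ |X m ω - c|}) atTop (𝓝 0)

/-- The basic independence model for `m` p-values. `I₀` is the set of true null hypotheses, its
complement is the set of false ones (whose p-values may depend on each other arbitrarily). -/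
structure BasicIndependence {Ω : Type*} [MeasurableSpace Ω] (P : Measure Ω) {m : ℕ}
    (I₀ : Finset (Fin m)) (p : Fin m → Ω → ℝ) : Prop where
  measurable : ∀ i, Measurable (p i)
  mem_Icc : ∀ i ω, p i ω ∈ Set.Icc (0 : ℝ) 1
  indep_true_false : IndepFun (fun ω (i : {i // i ∈ I₀}) => p i ω)
    (fun ω (i : {i // i ∉ I₀}) => p i ω) P
  indep_true : iIndepFun (fun (i : {i // i ∈ I₀}) ω => p i ω) P
  uniform_true : ∀ i ∈ I₀, ∀ x ∈ Set.Icc (0 : ℝ) 1, P {ω | p i ω ≤ x} = ENNReal.ofReal x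

/-- Empirical distribution function of the p-values `x 0, …, x (m - 1)`. -/
def ecdf {m : ℕ} (x : Fin m → ℝ) (t : ℝ) : ℝ :=
  ((Finset.univ.filter (fun i => x i ≤ t)).card : ℝ) / m

/-- `R_m(t) = m F̂_m(t)`, the number of p-values that are at most `t`. -/
def countLE {m : ℕ} (x : Fin m → ℝ) (t : ℝ) : ℝ :=
  m * ecdf x t

/-- The order statistics `x_{1:m} ≤ … ≤ x_{m:m}`, with `x_{0:m} = 0` (and the unused value `0`
for `i > m`). -/
def orderStat {m : ℕ} (x : Fin m → ℝ) (i : ℕ) : ℝ :=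
  if h : 1 ≤ i ∧ i ≤ m then x (Tuple.sort x ⟨i - 1, by omega⟩) else 0

/-- The data driven critical values `α̂_{i:m} = min {(i / m̂₀) α, λ}`; in particular
`α̂_{0:m} = 0`. The argument `μ` is the value of the estimator `m̂₀`. -/
def critVal (α lam μ : ℝ) (i : ℕ) : ℝ :=
  min ((i / μ) * α) lam

open Classical in
/-- Number of rejections `R_m = max {i = 0, …, m : x_{i:m} ≤ α̂_{i:m}}` of the adaptive step-up
test. -/
def numRejections {m : ℕ} (α lam μ : ℝ) (x : Fin m → ℝ) : ℕ :=
  Nat.findGreatest (fun i => orderStat x i ≤ critVal α lam μ i) m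

/-- `m̂₀` is a positive estimator that is a measurable function of `(F̂_m(t))_{t ≥ λ}` only. -/
def IsEstimator {Ω : Type*} {m : ℕ} (lam : ℝ) (p : Fin m → Ω → ℝ) (m0hat : Ω → ℝ) : Prop :=
  (∀ ω, 0 < m0hat ω) ∧
    ∃ g : (Set.Ici lam → ℝ) → ℝ, Measurable g ∧
      ∀ ω, m0hat ω = g (fun t => ecdf (fun i => p i ω) t)

end AdaptiveStepUp

end

/-!
Suppose `F̂_m` is uniformly within `δ` of the identity on `[0, 1]`, and let `t = α̂_{R_m:m}` be the
selected critical value. Since `R_m ≤ R_m(t)` and `t ≤ (R_m / m̂₀) α`, the lower bound on `m̂₀` gives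
`C t F̂_m(λ) ≤ λ F̂_m(t)`. Replacing `F̂_m` by the identity, at the cost of `δ`, leaves
`(C - 1) t < (C + 1) δ`, so `t` is small.

The uniform closeness is a Glivenko–Cantelli theorem in probability: Chebyshev's inequality gives the
pointwise law of large numbers for the true p-values, the false ones are asymptotically negligible,
and for monotone functions pointwise convergence to a continuous limit is uniform on compact
intervals.
-/

namespace AdaptiveStepUp

/-! ### Step-up tests for fixed p-values -/

section StepUp

variable {m : ℕ} (x : Fin m → ℝ)

lemma countLE_eq_card (t : ℝ) : countLE x t = Finset.card {i | x i ≤ t} := by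
  rcases eq_or_ne m 0 with rfl | hm
  · simp [countLE]
  · exact mul_div_cancel₀ _ (Nat.cast_ne_zero.2 hm)

lemma ecdf_eq_countLE_div (t : ℝ) : ecdf x t = countLE x t / m := by
  rw [countLE_eq_card, ecdf]

lemma monotone_ecdf : Monotone (ecdf x) := fun s t hst => by
  unfold ecdf
  gcongr

lemma orderStat_le_iff {i : ℕ} (hi : 1 ≤ i) (him : i ≤ m) (t : ℝ) :
    orderStat x i ≤ t ↔ (i : ℝ) ≤ countLE x t := by
  have hcard : Finset.card {j | x (Tuple.sort x j) ≤ t} = Finset.card {j | x j ≤ t} :=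
    Finset.card_equiv (Tuple.sort x) (by simp)
  have hsort := Tuple.lt_card_le_iff_apply_le_of_monotone (j := ⟨i - 1, by omega⟩) (a := t)
    (Tuple.monotone_sort x)
  simp only [Function.comp_apply, hcard] at hsort
  rw [orderStat, dif_pos ⟨hi, him⟩, ← hsort, countLE_eq_card, Nat.cast_le]
  omega

lemma numRejections_le_countLE (α lam μ : ℝ) :
    (numRejections α lam μ x : ℝ) ≤ countLE x (critVal α lam μ (numRejections α lam μ x)) := by
  classical
  rcases Nat.eq_zero_or_pos (numRejections α lam μ x) with h0 | hpos
  · rw [h0, countLE_eq_card]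
    exact Nat.cast_le.2 (Nat.zero_le _)
  · rw [← orderStat_le_iff x hpos (Nat.findGreatest_le m)]
    exact Nat.findGreatest_of_ne_zero (P := fun i => orderStat x i ≤ critVal α lam μ i) rfl hpos.ne'

variable {α lam μ C δ : ℝ}

lemma critVal_mem_Icc (hα : 0 ≤ α) (hlam : 0 ≤ lam) (hμ : 0 ≤ μ) (i : ℕ) :
    critVal α lam μ i ∈ Set.Icc 0 lam :=
  ⟨le_min (by positivity) hlam, min_le_right _ _⟩

lemma critVal_mul_le (hμ : 0 < μ) (i : ℕ) : critVal α lam μ i * μ ≤ i * α := by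
  rw [← le_div_iff₀ hμ, mul_div_right_comm]
  exact min_le_left _ _

lemma min_le_critVal (hα : 0 ≤ α) (hμ : 0 < μ) {a : ℝ} {i : ℕ} (h : a * μ ≤ i) :
    min (a * α) lam ≤ critVal α lam μ i :=
  min_le_min_right _ (mul_le_mul_of_nonneg_right ((le_div_iff₀ hμ).2 h) hα)

lemma mul_ecdf_le_mul_ecdf_critVal (hα : 0 < α) (hlam : 0 < lam) (hμ : 0 < μ)
    (hest : C * α / lam * countLE x lam ≤ μ) :
    C * critVal α lam μ (numRejections α lam μ x) * ecdf x lam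
      ≤ lam * ecdf x (critVal α lam μ (numRejections α lam μ x)) := by
  set R := numRejections α lam μ x
  set t := critVal α lam μ R
  have ht : 0 ≤ t := (critVal_mem_Icc hα.le hlam.le hμ.le R).1
  have hscaled : C * t * countLE x lam ≤ lam * countLE x t := by
    refine le_of_mul_le_mul_left ?_ hα
    calc α * (C * t * countLE x lam) = lam * (t * (C * α / lam * countLE x lam)) := by field_simp
      _ ≤ lam * (t * μ) := by gcongr
      _ ≤ lam * (R * α) := mul_le_mul_of_nonneg_left (critVal_mul_le hμ R) hlam.le
      _ ≤ lam * (countLE x t * α) := by gcongr; exact numRejections_le_countLE x α lam μ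
      _ = α * (lam * countLE x t) := by ring
  rw [ecdf_eq_countLE_div, ecdf_eq_countLE_div, ← mul_div_assoc, ← mul_div_assoc]
  gcongr

lemma mul_critVal_numRejections_lt (hα : 0 < α) (hlam : 0 < lam) (hμ : 0 < μ) (hC : 0 ≤ C)
    (hest : C * α / lam * countLE x lam ≤ μ)
    (hF : ∀ t ∈ Set.Icc 0 lam, |ecdf x t - t| < δ) :
    (C - 1) * critVal α lam μ (numRejections α lam μ x) < (C + 1) * δ := by
  have hratio := mul_ecdf_le_mul_ecdf_critVal x hα hlam hμ hest
  obtain ⟨ht, htlam⟩ := critVal_mem_Icc hα.le hlam.le hμ.le (numRejections α lam μ x)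
  set t := critVal α lam μ (numRejections α lam μ x)
  have hFt : ecdf x t < t + δ := by linarith [(abs_lt.1 (hF t ⟨ht, htlam⟩)).2]
  have hFlam : lam - δ ≤ ecdf x lam := by linarith [(abs_lt.1 (hF lam ⟨hlam.le, le_rfl⟩)).1]
  have hδ : 0 ≤ δ := (abs_nonneg _).trans (hF t ⟨ht, htlam⟩).le
  have hchain : C * t * (lam - δ) < lam * (t + δ) := calc
    C * t * (lam - δ) ≤ C * t * ecdf x lam := by gcongr
    _ ≤ lam * ecdf x t := hratio
    _ < lam * (t + δ) := by gcongr
  have hCδ : C * t * δ ≤ C * lam * δ := by gcongr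
  refine lt_of_mul_lt_mul_left ?_ hlam.le
  linarith

lemma abs_countLE_sub_le (I : Finset (Fin m)) {t : ℝ} (ht : t ∈ Set.Icc (0 : ℝ) 1) :
    |countLE x t - m * t| ≤ |Finset.card {i ∈ I | x i ≤ t} - I.card * t| + (m - I.card) := by
  have hsplit : countLE x t = Finset.card {i ∈ I | x i ≤ t} + Finset.card {i ∈ Iᶜ | x i ≤ t} := by
    rw [countLE_eq_card]
    simp only [Finset.card_filter, ← Finset.sum_add_sum_compl I, Nat.cast_add]
  have hcompl : (Iᶜ.card : ℝ) = m - I.card := by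
    rw [eq_sub_iff_add_eq', ← Nat.cast_add, Finset.card_add_card_compl, Fintype.card_fin]
  have hfilter : (Finset.card {i ∈ Iᶜ | x i ≤ t} : ℝ) ≤ Iᶜ.card :=
    Nat.cast_le.2 (Finset.card_filter_le _ _)
  have hfalse : |(Finset.card {i ∈ Iᶜ | x i ≤ t} : ℝ) - Iᶜ.card * t| ≤ Iᶜ.card :=
    abs_sub_le_of_nonneg_of_le (Nat.cast_nonneg _) hfilter
      (mul_nonneg (Nat.cast_nonneg _) ht.1) (mul_le_of_le_one_right (Nat.cast_nonneg _) ht.2)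
  rw [← hcompl]
  calc |countLE x t - m * t|
      = |(Finset.card {i ∈ I | x i ≤ t} - I.card * t)
          + (Finset.card {i ∈ Iᶜ | x i ≤ t} - Iᶜ.card * t)| := by
        rw [hsplit, hcompl]; ring_nf
    _ ≤ _ := (abs_add_le _ _).trans (add_le_add_right hfalse _)

end StepUp

/-! ### Convergence in probability -/

section VanishingProbability

variable {ι : Type*} {l : Filter ι} {Ω : ι → Type*} [∀ m, MeasurableSpace (Ω m)]
  {P : ∀ m, Measure (Ω m)} {A B : ∀ m, Set (Ω m)}

lemma tendsto_measure_zero_mono_ae (hB : Tendsto (fun m => P m (B m)) l (𝓝 0))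
    (hAB : ∀ᶠ m in l, A m ≤ᵐ[P m] B m) : Tendsto (fun m => P m (A m)) l (𝓝 0) :=
  tendsto_of_tendsto_of_tendsto_of_le_of_le' tendsto_const_nhds hB
    (Eventually.of_forall fun _ => zero_le) (hAB.mono fun _ => measure_mono_ae)

lemma tendsto_measure_zero_mono (hB : Tendsto (fun m => P m (B m)) l (𝓝 0))
    (hAB : ∀ᶠ m in l, A m ⊆ B m) : Tendsto (fun m => P m (A m)) l (𝓝 0) :=
  tendsto_measure_zero_mono_ae hB (hAB.mono fun _ h => h.eventuallyLE)

lemma tendsto_measure_union_zero (hA : Tendsto (fun m => P m (A m)) l (𝓝 0))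
    (hB : Tendsto (fun m => P m (B m)) l (𝓝 0)) :
    Tendsto (fun m => P m (A m ∪ B m)) l (𝓝 0) :=
  tendsto_of_tendsto_of_tendsto_of_le_of_le tendsto_const_nhds
    (by simpa only [add_zero] using hA.add hB) (fun _ => zero_le) (fun _ => measure_union_le _ _)

lemma tendsto_measure_compl_zero [∀ m, IsProbabilityMeasure (P m)]
    (hA : ∀ᶠ m in l, MeasurableSet (A m)) (h : Tendsto (fun m => P m (A m)) l (𝓝 1)) :
    Tendsto (fun m => P m (A m)ᶜ) l (𝓝 0) := by
  have hsub : Tendsto (fun m => 1 - P m (A m)) l (𝓝 0) := by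
    simpa using ENNReal.Tendsto.sub tendsto_const_nhds h (Or.inl ENNReal.one_ne_top)
  exact hsub.congr' (hA.mono fun _ hm => (prob_compl_eq_one_sub hm).symm)

end VanishingProbability

section ConvergenceInProbability

variable {Ω : ℕ → Type*} [∀ m, MeasurableSpace (Ω m)] {P : ∀ m, Measure (Ω m)}

lemma tendstoInProb_zero_iff_of_nonneg {X : ∀ m, Ω m → ℝ} (hX : ∀ᶠ m in atTop, ∀ ω, 0 ≤ X m ω) :
    TendstoInProb P X 0 ↔
      ∀ ε : ℝ, 0 < ε → Tendsto (fun m => P m {ω | ε ≤ X m ω}) atTop (𝓝 0) := by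
  refine forall₂_congr fun ε _ => tendsto_congr' (hX.mono fun m hm => ?_)
  simp only [sub_zero, abs_of_nonneg (hm _)]

/-- Uniform convergence on `S`, in `P m`-probability, of the random functions `F m` to the
nonrandom function `G`. The bad event is written with `∃ t ∈ S` rather than with a supremum, whose
value on unbounded sets would be junk; it need not be measurable, in which case `P m` is its outer
measure. -/
def TendstoUniformlyOnInProb (P : ∀ m, Measure (Ω m)) (F : ∀ m, Ω m → ℝ → ℝ) (G : ℝ → ℝ)
    (S : Set ℝ) : Prop :=
  ∀ ε : ℝ, 0 < ε → Tendsto (fun m => P m {ω | ∃ t ∈ S, ε ≤ |F m ω t - G t|}) atTop (𝓝 0)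

lemma TendstoUniformlyOnInProb.mono {F : ∀ m, Ω m → ℝ → ℝ} {G : ℝ → ℝ} {S T : Set ℝ}
    (h : TendstoUniformlyOnInProb P F G T) (hST : S ⊆ T) : TendstoUniformlyOnInProb P F G S :=
  fun ε hε => tendsto_measure_zero_mono (h ε hε)
    (Eventually.of_forall fun _ _ ⟨t, ht, hle⟩ => ⟨t, hST ht, hle⟩)

lemma abs_sub_lt_of_monotoneOn_Icc {f g : ℝ → ℝ} {u v t c ε : ℝ} (hf : MonotoneOn f (Set.Icc u v))
    (ht : t ∈ Set.Icc u v) (hg : ∀ s ∈ Set.Icc u v, |g s - c| < ε / 3)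
    (hu : |f u - g u| < ε / 3) (hv : |f v - g v| < ε / 3) : |f t - g t| < ε := by
  have huv : u ≤ v := ht.1.trans ht.2
  have hut := hf (Set.left_mem_Icc.2 huv) ht ht.1
  have htv := hf ht (Set.right_mem_Icc.2 huv) ht.2
  have hgu := abs_lt.1 (hg u (Set.left_mem_Icc.2 huv))
  have hgv := abs_lt.1 (hg v (Set.right_mem_Icc.2 huv))
  have hgt := abs_lt.1 (hg t ht)
  rw [abs_lt] at hu hv ⊢
  constructor <;> linarith

lemma exists_Icc_mem_nhdsWithin_abs_sub_lt {g : ℝ → ℝ} {a b s δ : ℝ}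
    (hg : ContinuousOn g (Set.Icc a b)) (hs : s ∈ Set.Icc a b) (hδ : 0 < δ) :
    ∃ u v, u ≤ v ∧ Set.Icc u v ⊆ Set.Icc a b ∧ Set.Icc u v ∈ 𝓝[Set.Icc a b] s ∧
      ∀ t ∈ Set.Icc u v, |g t - g s| < δ := by
  obtain ⟨η, hη, hgs⟩ := Metric.continuousOn_iff.1 hg s hs δ hδ
  refine ⟨a ⊔ (s - η / 2), b ⊓ (s + η / 2), ?_, ?_⟩
  · exact le_trans (b := s) (sup_le hs.1 (by linarith)) (le_inf hs.2 (by linarith))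
  rw [← Set.Icc_inter_Icc]
  refine ⟨Set.inter_subset_left,
    inter_mem_nhdsWithin _ (Icc_mem_nhds (by linarith) (by linarith)), fun t ht => hgs t ht.1 ?_⟩
  rw [Real.dist_eq, abs_lt]
  constructor <;> linarith [ht.2.1, ht.2.2]

theorem tendstoUniformlyOnInProb_of_monotoneOn {F : ∀ m, Ω m → ℝ → ℝ} {G : ℝ → ℝ} {a b : ℝ}
    (hF : ∀ m ω, MonotoneOn (F m ω) (Set.Icc a b)) (hG : ContinuousOn G (Set.Icc a b))
    (hlim : ∀ t ∈ Set.Icc a b, TendstoInProb P (fun m ω => F m ω t) (G t)) :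
    TendstoUniformlyOnInProb P F G (Set.Icc a b) := by
  intro ε hε
  refine isCompact_Icc.induction_on
    (p := fun K => Tendsto (fun m => P m {ω | ∃ t ∈ K, ε ≤ |F m ω t - G t|}) atTop (𝓝 0))
    (by simp) (fun K L hKL hL => ?_) (fun K L hK hL => ?_) (fun s hs => ?_)
  · exact tendsto_measure_zero_mono hL
      (Eventually.of_forall fun _ _ ⟨t, ht, hle⟩ => ⟨t, hKL ht, hle⟩)
  · simpa only [Set.mem_union, or_and_right, exists_or, Set.ofPred_or]
      using tendsto_measure_union_zero hK hL
  · obtain ⟨u, v, huv, hsub, hnhds, hosc⟩ :=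
      exists_Icc_mem_nhdsWithin_abs_sub_lt hG hs (show 0 < ε / 3 by positivity)
    refine ⟨_, hnhds, ?_⟩
    refine tendsto_measure_zero_mono
      (tendsto_measure_union_zero (hlim u (hsub (Set.left_mem_Icc.2 huv)) (ε / 3) (by positivity))
        (hlim v (hsub (Set.right_mem_Icc.2 huv)) (ε / 3) (by positivity)))
      (Eventually.of_forall fun m ω => ?_)
    rintro ⟨t, ht, hle⟩
    by_contra! hcon
    simp only [Set.mem_union, Set.mem_ofPred_eq, not_or, not_le] at hcon
    exact hle.not_gt (abs_sub_lt_of_monotoneOn_Icc ((hF m ω).mono hsub) ht hosc hcon.1 hcon.2)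

end ConvergenceInProbability

/-! ### Law of large numbers for the empirical distribution function -/

section LawOfLargeNumbers

lemma measure_le_abs_sum_sub_integral_le {Ω ι : Type*} [MeasurableSpace Ω] {P : Measure Ω}
    [IsProbabilityMeasure P] {s : Finset ι} {X : ι → Ω → ℝ} {a b c : ℝ}
    (hX : ∀ i ∈ s, AEMeasurable (X i) P) (hab : ∀ i ∈ s, ∀ᵐ ω ∂P, X i ω ∈ Set.Icc a b)
    (hindep : (s : Set ι).Pairwise fun i j => X i ⟂ᵢ[P] X j) (hc : 0 < c) :
    P {ω | c ≤ |∑ i ∈ s, X i ω - ∑ i ∈ s, P[X i]|}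
      ≤ ENNReal.ofReal (s.card * ((b - a) / 2) ^ 2 / c ^ 2) := by
  have hL2 : ∀ i ∈ s, MemLp (X i) 2 P := fun i hi =>
    memLp_of_bounded (hab i hi) (hX i hi).aestronglyMeasurable 2
  have hmean : ∫ ω, ∑ i ∈ s, X i ω ∂P = ∑ i ∈ s, P[X i] :=
    integral_finsetSum _ fun i hi => (hL2 i hi).integrable one_le_two
  have hvar : variance (∑ i ∈ s, X i) P ≤ s.card * ((b - a) / 2) ^ 2 := by
    rw [IndepFun.variance_sum hL2 hindep, ← nsmul_eq_mul]
    exact Finset.sum_le_card_nsmul _ _ _ fun i hi => variance_le_sq_of_bounded (hab i hi) (hX i hi)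
  have hcheb := meas_ge_le_variance_div_sq (memLp_finsetSum' s hL2) hc
  simp only [Finset.sum_apply, hmean] at hcheb
  exact hcheb.trans (ENNReal.ofReal_le_ofReal (by gcongr))

/-- The part of the basic independence model that drives the law of large numbers: pairwise
independent, uniformly distributed random variables `X i`, `i ∈ s`, with no condition on the
remaining ones. -/
structure PairwiseIndepUniformOn {Ω ι : Type*} [MeasurableSpace Ω] (P : Measure Ω) (s : Finset ι)
    (X : ι → Ω → ℝ) : Prop where
  aemeasurable : ∀ i ∈ s, AEMeasurable (X i) P
  pairwise_indepFun : (s : Set ι).Pairwise fun i j => X i ⟂ᵢ[P] X j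
  measure_le : ∀ i ∈ s, ∀ t ∈ Set.Icc (0 : ℝ) 1, P {ω | X i ω ≤ t} = ENNReal.ofReal t

lemma BasicIndependence.pairwiseIndepUniformOn {Ω : Type*} [MeasurableSpace Ω] {P : Measure Ω}
    {m : ℕ} {I₀ : Finset (Fin m)} {p : Fin m → Ω → ℝ} (h : BasicIndependence P I₀ p) :
    PairwiseIndepUniformOn P I₀ p where
  aemeasurable i _ := (h.measurable i).aemeasurable
  pairwise_indepFun i hi j hj hij :=
    h.indep_true.indepFun (i := ⟨i, hi⟩) (j := ⟨j, hj⟩) (by simpa using hij)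
  measure_le := h.uniform_true

lemma PairwiseIndepUniformOn.measure_le_abs_card_sub_le {Ω ι : Type*} [MeasurableSpace Ω]
    {P : Measure Ω} [IsProbabilityMeasure P] {s : Finset ι} {X : ι → Ω → ℝ}
    (h : PairwiseIndepUniformOn P s X) {t : ℝ} (ht : t ∈ Set.Icc (0 : ℝ) 1) {c : ℝ} (hc : 0 < c) :
    P {ω | c ≤ |Finset.card {i ∈ s | X i ω ≤ t} - s.card * t|}
      ≤ ENNReal.ofReal (s.card / (2 * c) ^ 2) := by
  let φ : ℝ → ℝ := (Set.Iic t).indicator 1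
  have hφ : Measurable φ := measurable_one.indicator measurableSet_Iic
  have hφ01 : ∀ y, φ y ∈ Set.Icc (0 : ℝ) 1 := fun y =>
    ⟨Set.indicator_nonneg (by simp) y, Set.indicator_le_self' (by simp) y⟩
  have hmean : ∀ i ∈ s, P[φ ∘ X i] = t := fun i hi => by
    have hset : NullMeasurableSet {ω | X i ω ≤ t} P :=
      (h.aemeasurable i hi).nullMeasurableSet_preimage measurableSet_Iic
    calc P[φ ∘ X i] = ∫ ω, {ω | X i ω ≤ t}.indicator 1 ω ∂P := rfl
      _ = P.real {ω | X i ω ≤ t} := by simp [integral_indicator₀ hset]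
      _ = t := by rw [Measure.real, h.measure_le i hi t ht, ENNReal.toReal_ofReal ht.1]
  have hcount : ∀ ω, ∑ i ∈ s, (φ ∘ X i) ω = Finset.card {i ∈ s | X i ω ≤ t} := fun ω => by
    simp [φ, Set.indicator_apply]
  have hcheb := measure_le_abs_sum_sub_integral_le (c := c)
    (fun i hi => hφ.comp_aemeasurable (h.aemeasurable i hi))
    (fun i _ => ae_of_all P fun ω => hφ01 (X i ω))
    (fun i hi j hj hij => (h.pairwise_indepFun hi hj hij).comp hφ hφ) hc
  rw [Finset.sum_congr rfl hmean, Finset.sum_const, nsmul_eq_mul] at hcheb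
  simp only [hcount] at hcheb
  convert! hcheb using 2
  field_simp
  ring

variable {Ω : ℕ → Type*} [∀ m, MeasurableSpace (Ω m)] {P : ∀ m, Measure (Ω m)}
  [∀ m, IsProbabilityMeasure (P m)] {I₀ : ∀ m, Finset (Fin m)} {p : ∀ m, Fin m → Ω m → ℝ}

lemma tendstoInProb_ecdf (hp : ∀ᶠ m in atTop, PairwiseIndepUniformOn (P m) (I₀ m) (p m))
    (hI₀ : Tendsto (fun m : ℕ => ((I₀ m).card : ℝ) / m) atTop (𝓝 1)) {t : ℝ}
    (ht : t ∈ Set.Icc (0 : ℝ) 1) : TendstoInProb P (fun m ω => ecdf (fun i => p m i ω) t) t := by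
  intro ε hε
  have hbound : Tendsto (fun m : ℕ => ENNReal.ofReal (1 / ε ^ 2 / m)) atTop (𝓝 0) := by
    simpa only [ENNReal.ofReal_zero]
      using ENNReal.tendsto_ofReal (tendsto_const_div_atTop_nhds_zero_nat (1 / ε ^ 2))
  refine tendsto_of_tendsto_of_tendsto_of_le_of_le' tendsto_const_nhds hbound
    (Eventually.of_forall fun _ => zero_le) ?_
  filter_upwards [hp, eventually_ge_atTop 1,
    hI₀.eventually (lt_mem_nhds (show 1 - ε / 2 < 1 by linarith))] with m hpm hm hm₀
  have hmpos : (0 : ℝ) < m := Nat.cast_pos.2 hm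
  have hcard : ((I₀ m).card : ℝ) ≤ m := Nat.cast_le.2 (card_finset_fin_le _)
  rw [lt_div_iff₀ hmpos] at hm₀
  calc P m {ω | ε ≤ |ecdf (fun i => p m i ω) t - t|}
      ≤ P m {ω | ε / 2 * m ≤ |Finset.card {i ∈ I₀ m | p m i ω ≤ t} - (I₀ m).card * t|} := by
        refine measure_mono fun ω hω => ?_
        have hdev : ε * m ≤ |countLE (fun i => p m i ω) t - m * t| := by
          rwa [← le_div_iff₀ hmpos, ← abs_of_pos hmpos, ← abs_div, abs_of_pos hmpos, sub_div,
            ← ecdf_eq_countLE_div, mul_div_cancel_left₀ _ hmpos.ne']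
        have hle := abs_countLE_sub_le (fun i => p m i ω) (I₀ m) ht
        rw [Set.mem_ofPred_eq]
        linarith
    _ ≤ ENNReal.ofReal ((I₀ m).card / (2 * (ε / 2 * m)) ^ 2) :=
        hpm.measure_le_abs_card_sub_le ht (by positivity)
    _ ≤ ENNReal.ofReal (m / (2 * (ε / 2 * m)) ^ 2) := by gcongr
    _ = ENNReal.ofReal (1 / ε ^ 2 / m) := by congr 1; field_simp

theorem tendstoUniformlyOnInProb_ecdf
    (hp : ∀ᶠ m in atTop, PairwiseIndepUniformOn (P m) (I₀ m) (p m))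
    (hI₀ : Tendsto (fun m : ℕ => ((I₀ m).card : ℝ) / m) atTop (𝓝 1)) :
    TendstoUniformlyOnInProb P (fun m ω => ecdf fun i => p m i ω) id (Set.Icc 0 1) :=
  tendstoUniformlyOnInProb_of_monotoneOn (fun _ _ => (monotone_ecdf _).monotoneOn _)
    continuousOn_id fun _ ht => tendstoInProb_ecdf hp hI₀ ht

end LawOfLargeNumbers

/-! ### Consistency of the adaptive test -/

section Consistency

variable {Ω : ℕ → Type*} [∀ m, MeasurableSpace (Ω m)] {P : ∀ m, Measure (Ω m)}
  {p : ∀ m, Fin m → Ω m → ℝ} {m0hat : ∀ m, Ω m → ℝ} {α lam : ℝ}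

lemma tendstoInProb_critVal_numRejections (hα : 0 < α) (hlam : 0 < lam)
    (hm0hat : ∀ᶠ m in atTop, ∀ ω, 0 < m0hat m ω)
    (hF : TendstoUniformlyOnInProb P (fun m ω => ecdf fun i => p m i ω) id (Set.Icc 0 lam))
    {C : ℝ} (hC : 1 < C) (hest : Tendsto
      (fun m => P m {ω | m0hat m ω < C * α / lam * countLE (fun i => p m i ω) lam}) atTop (𝓝 0)) :
    TendstoInProb P (fun m ω => critVal α lam (m0hat m ω)
      (numRejections α lam (m0hat m ω) (fun i => p m i ω))) 0 := by
  rw [tendstoInProb_zero_iff_of_nonneg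
    (hm0hat.mono fun m hm ω => (critVal_mem_Icc hα.le hlam.le (hm ω).le _).1)]
  intro ε hε
  have hC₀ : 0 < C - 1 := sub_pos.2 hC
  have hC₁ : 0 < C + 1 := by linarith
  refine tendsto_measure_zero_mono (tendsto_measure_union_zero hest
    (hF ((C - 1) * ε / (C + 1)) (by positivity))) (hm0hat.mono fun m hm ω hω => ?_)
  by_contra! hgood
  simp only [Set.mem_union, Set.mem_ofPred_eq, not_or, not_lt, not_exists, not_and, not_le, id]
    at hgood
  have hlt := mul_critVal_numRejections_lt _ hα hlam (hm ω) (by linarith) hgood.1 hgood.2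
  rw [mul_div_cancel₀ _ hC₁.ne'] at hlt
  exact hω.not_gt (lt_of_mul_lt_mul_left hlt hC₀.le)

lemma TendstoInProb.div_of_critVal {R : ∀ m, Ω m → ℕ} {K : ℝ} (hα : 0 < α) (hlam : 0 < lam)
    (hm0hat : ∀ᶠ m in atTop, ∀ ω, 0 < m0hat m ω) (hK : 0 < K)
    (hle : ∀ᶠ m : ℕ in atTop, ∀ᵐ ω ∂(P m), m0hat m ω ≤ K * m)
    (h : TendstoInProb P (fun m ω => critVal α lam (m0hat m ω) (R m ω)) 0) :
    TendstoInProb P (fun m ω => (R m ω : ℝ) / m) 0 := by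
  rw [tendstoInProb_zero_iff_of_nonneg
    (hm0hat.mono fun m hm ω => (critVal_mem_Icc hα.le hlam.le (hm ω).le _).1)] at h
  rw [tendstoInProb_zero_iff_of_nonneg (Eventually.of_forall fun m ω => by positivity)]
  intro η hη
  refine tendsto_measure_zero_mono_ae (h (min (η / K * α) lam) (lt_min (by positivity) hlam)) ?_
  filter_upwards [hm0hat, hle, eventually_ge_atTop 1] with m hpos hlem hm
  filter_upwards [hlem] with ω hω hηR
  refine min_le_critVal hα.le (hpos ω) ?_
  calc η / K * m0hat m ω ≤ η / K * (K * m) := by gcongr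
    _ = η * m := by field_simp
    _ ≤ R m ω := (le_div_iff₀ (Nat.cast_pos.2 hm)).1 hηR

end Consistency

/-! ### Measurability of the estimator -/

lemma measurable_countLE {Ω : Type*} [MeasurableSpace Ω] {m : ℕ} {p : Fin m → Ω → ℝ}
    (hp : ∀ i, Measurable (p i)) (t : ℝ) : Measurable fun ω => countLE (fun i => p i ω) t := by
  simp only [countLE_eq_card, Finset.card_filter, Nat.cast_sum]
  exact Finset.measurable_sum _ fun i _ => Measurable.comp (by fun_prop) <|
    Measurable.ite (measurableSet_le (hp i) measurable_const) measurable_const measurable_const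

lemma IsEstimator.measurable {Ω : Type*} [MeasurableSpace Ω] {m : ℕ} {lam : ℝ}
    {p : Fin m → Ω → ℝ} {m0hat : Ω → ℝ} (h : IsEstimator lam p m0hat)
    (hp : ∀ i, Measurable (p i)) : Measurable m0hat := by
  obtain ⟨-, g, hg, hm0hat⟩ := h
  simp only [funext hm0hat, ecdf_eq_countLE_div]
  exact hg.comp (measurable_pi_lambda _ fun t => (measurable_countLE hp t).div_const _)

lemma tendsto_measure_estimator_lt {Ω : ℕ → Type*} [∀ m, MeasurableSpace (Ω m)]
    {P : ∀ m, Measure (Ω m)} [∀ m, IsProbabilityMeasure (P m)] {p : ∀ m, Fin m → Ω m → ℝ}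
    {m0hat : ∀ m, Ω m → ℝ} {lam c : ℝ} (hc : 0 ≤ c)
    (hp : ∀ᶠ m in atTop, ∀ i, Measurable (p m i))
    (hest : ∀ᶠ m in atTop, IsEstimator lam (p m) (m0hat m))
    (h : Tendsto (fun m => P m {ω | c * max (countLE (fun i => p m i ω) lam) 1 ≤ m0hat m ω})
      atTop (𝓝 1)) :
    Tendsto (fun m => P m {ω | m0hat m ω < c * countLE (fun i => p m i ω) lam}) atTop (𝓝 0) := by
  refine tendsto_measure_zero_mono (tendsto_measure_compl_zero ?_ h)
    (Eventually.of_forall fun m ω hω => ?_)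
  · filter_upwards [hp, hest] with m hpm hestm
    exact measurableSet_le (((measurable_countLE hpm lam).max measurable_const).const_mul c)
      (hestm.measurable hpm)
  · exact not_le.2 (lt_of_lt_of_le hω (mul_le_mul_of_nonneg_left (le_max_left _ _) hc))

end AdaptiveStepUp

open AdaptiveStepUp in
theorem lemma5p2_general {Ω : ℕ → Type*} [∀ m, MeasurableSpace (Ω m)]
    (P : ∀ m, Measure (Ω m)) [∀ m, IsProbabilityMeasure (P m)]
    {α lam : ℝ} (hα : 0 < α) (hlam₀ : 0 < lam) (hlam₁ : lam ≤ 1)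
    (I₀ : ∀ m, Finset (Fin m)) (p : ∀ m, Fin m → Ω m → ℝ) (m0hat : ∀ m, Ω m → ℝ)
    (hp : ∀ m, 1 ≤ m → PairwiseIndepUniformOn (P m) (I₀ m) (p m))
    (hm0hat : ∀ m, 1 ≤ m → ∀ ω, 0 < m0hat m ω)
    (hI₀ : Tendsto (fun m : ℕ => ((I₀ m).card : ℝ) / m) atTop (𝓝 1))
    (hest : ∃ C : ℝ, 1 < C ∧ Tendsto (fun m => P m {ω |
      m0hat m ω < C * α / lam * countLE (fun i => p m i ω) lam}) atTop (𝓝 0)) :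
    TendstoInProb P (fun m ω => critVal α lam (m0hat m ω)
      (numRejections α lam (m0hat m ω) (fun i => p m i ω))) 0 ∧
    ((∃ K : ℝ, 0 < K ∧ ∀ m : ℕ, 1 ≤ m → ∀ᵐ ω ∂(P m), m0hat m ω ≤ K * m) →
      TendstoInProb P
        (fun m ω => (numRejections α lam (m0hat m ω) (fun i => p m i ω) : ℝ) / m) 0) := by
  obtain ⟨C, hC, hlt⟩ := hest
  have hev : ∀ᶠ m : ℕ in atTop, 1 ≤ m := eventually_ge_atTop 1
  have hF := (tendstoUniformlyOnInProb_ecdf (hev.mono hp) hI₀).mono (Set.Icc_subset_Icc_right hlam₁)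
  have hcrit := tendstoInProb_critVal_numRejections hα hlam₀ (hev.mono hm0hat) hF hC hlt
  exact ⟨hcrit, fun ⟨_, hK, hle⟩ =>
    hcrit.div_of_critVal hα hlam₀ (hev.mono hm0hat) hK (hev.mono hle)⟩

theorem lemma5p2 {Ω : ℕ → Type*} [∀ m, MeasurableSpace (Ω m)]
    (P : ∀ m, Measure (Ω m)) [∀ m, IsProbabilityMeasure (P m)]
    (α lam : ℝ) (hα : 0 < α) (hαlam : α ≤ lam) (hlam : lam < 1)
    -- for each number `m ≥ 1` of hypotheses: true nulls, p-values and the estimator of `m₀`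
    (I₀ : ∀ m, Finset (Fin m)) (p : ∀ m, Fin m → Ω m → ℝ) (m0hat : ∀ m, Ω m → ℝ)
    (hBI : ∀ m, 1 ≤ m → AdaptiveStepUp.BasicIndependence (P m) (I₀ m) (p m))
    (hm0 : ∀ m, 1 ≤ m → 1 ≤ (I₀ m).card)
    (hest : ∀ m, 1 ≤ m → AdaptiveStepUp.IsEstimator lam (p m) (m0hat m))
    -- sparsity: `m₀ / m → 1`
    (hA1 : Tendsto (fun m : ℕ => ((I₀ m).card : ℝ) / m) atTop (𝓝 1))
    -- `m̂₀ ≥ (C α / λ) (R_m(λ) ∨ 1)` with probability tending to one, for some `C > 1`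
    (hA4 : ∃ C : ℝ, 1 < C ∧ Tendsto (fun m => P m {ω |
      C * α / lam * max (AdaptiveStepUp.countLE (fun i => p m i ω) lam) 1 ≤ m0hat m ω})
        atTop (𝓝 1)) :
    AdaptiveStepUp.TendstoInProb P
      (fun m ω => AdaptiveStepUp.critVal α lam (m0hat m ω)
        (AdaptiveStepUp.numRejections α lam (m0hat m ω) (fun i => p m i ω))) 0 ∧
    ((∃ K : ℝ, 0 < K ∧ ∀ m : ℕ, 1 ≤ m → ∀ᵐ ω ∂(P m), m0hat m ω ≤ K * m) →
      AdaptiveStepUp.TendstoInProb P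
        (fun m ω =>
          (AdaptiveStepUp.numRejections α lam (m0hat m ω) (fun i => p m i ω) : ℝ) / m) 0) := by
  obtain ⟨C, hC, hA⟩ := hA4
  have hc : 0 ≤ C * α / lam :=
    div_nonneg (mul_nonneg (zero_le_one.trans hC.le) hα.le) (hα.le.trans hαlam)
  have hev : ∀ᶠ m : ℕ in atTop, 1 ≤ m := eventually_ge_atTop 1
  exact lemma5p2_general P hα (hα.trans_le hαlam) hlam.le I₀ p m0hat
    (fun m hm => (hBI m hm).pairwiseIndepUniformOn) (fun m hm => (hest m hm).1) hA1
    ⟨C, hC, AdaptiveStepUp.tendsto_measure_estimator_lt hc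
      (hev.mono fun m hm => (hBI m hm).measurable) (hev.mono hest) hA⟩
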